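/- Let $U$ be a universal prefix machine on binary strings, $K_U(x\mid y)$ the conditional prefix complexity, $K_U(x)=K_U(x\mid\varepsilon)$, and write $I_{\mathrm{alg}}(x:y):=K_U(y)-K_U(y\mid x)$ for the algorithmic information that $x$ carries about $y$. An adaptation process $P$ is an effective system acting on configurations (control state, content of the execution substrate, content of the adaptation memory), the last two being binary strings. While it has not halted, it repeatedly applies a logically reversible (injective) operation, possibly followed by a logical erasure of one bit cell, i.e. an irreversible overwriting of that bit regardless of its value; which cell is erased does not depend on the bit that is lost. The written bit is $0$ for a reset to the standard state, but may also be supplied by the environment. $P$ is described by the source code of its one-step behaviour. For all constants $c_0,c_1\in\mathbb N$ there is a constant $c_U$, depending only on $U,c_0,c_1$, such that the following holds. Let $\sigma=\sigma(\mathcal C)$ be a binary string (the canonical descriptor of a task class $\mathcal C$), let $S_0$ be an initial state of the execution substrate that carries no information about $\sigma$, in the sense that $|K_U(\sigma\mid S_0)-K_U(\sigma)|\le c_0$, and let $\mathcal D$ be the adaptation input (initial content of the adaptation memory). Let $P$ be an adaptation process whose description $\mathrm{desc}(P)$ is of constant size relative to the input, $K_U(\mathrm{desc}(P)\mid \mathcal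 D)\le c_1$ (for instance a fixed process, or one whose source code is part of $\mathcal D$). If $P$, started on $(S_0,\mathcal D)$, can halt after exactly $H_{\mathrm{erase}}$ logical erasures in a configuration whose execution-substrate component is $S$, and $\mu:=I_{\mathrm{alg}}(S:\sigma)$, then $$H_{\mathrm{erase}}\;\ge\;\mu-I_{\mathrm{alg}}(\mathcal D:\sigma)-c_U .$$ -/

import Mathlib

/-- A conditional prefix machine: a partial recursive map `(program, condition) ↦ output` on binary
strings such that, for every condition, no halting program is a proper prefix of another one. -/
structure IsPrefixMachine (V : List Bool → List Bool →. List Bool) : Prop where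
  partrec : Partrec₂ V
  prefix_free : ∀ y p q, (V p y).Dom → (V q y).Dom → p <+: q → p = q

/-- A universal prefix machine: a prefix machine that produces every output of every other prefix
machine with a constant overhead in program length. -/
structure IsUniversalPrefixMachine (U : List Bool → List Bool →. List Bool) : Prop where
  isPrefixMachine : IsPrefixMachine U
  universal : ∀ V, IsPrefixMachine V →
    ∃ c : ℕ, ∀ p y x, x ∈ V p y → ∃ q, q.length ≤ p.length + c ∧ x ∈ U q y

/-- Conditional prefix complexity `K_U(x | y)`: the least length of a program that makes `U` output
`x` on condition `y`. (If `U` is universal, such a program always exists.) -/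
noncomputable def condK (U : List Bool → List Bool →. List Bool) (x y : List Bool) : ℕ :=
  sInf {n | ∃ p : List Bool, p.length = n ∧ x ∈ U p y}

/-- Prefix complexity `K_U(x)`: the condition is the empty string. -/
noncomputable def prefixK (U : List Bool → List Bool →. List Bool) (x : List Bool) : ℕ :=
  condK U x []

/-- Algorithmic mutual information `I(x : y) = K_U(y) - K_U(y | x)`, the information that `x`
carries about `y`. -/
noncomputable def algMutualInfo (U : List Bool → List Bool →. List Bool) (x y : List Bool) : ℤ :=
  (prefixK U y : ℤ) - (condK U y x : ℤ)

/-- A configuration of an adaptation process: the control state, the content of the execution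
substrate, the content of the adaptation memory. -/
abbrev Config : Type := ℕ × List Bool × List Bool

/-- The address of one bit cell: `Sum.inl i` is bit `i` of the execution substrate, `Sum.inr i` is
bit `i` of the adaptation memory. -/
abbrev Cell : Type := ℕ ⊕ ℕ

/-- The cell exists in the configuration. -/
def Config.HasCell (s : Config) : Cell → Prop
  | Sum.inl i => i < s.2.1.length
  | Sum.inr i => i < s.2.2.length

/-- Replace the content of a cell, whatever it was, by the bit `b`. -/
def Config.overwrite (s : Config) (k : Cell) (b : Bool) : Config :=
  match k with
  | Sum.inl i => (s.1, s.2.1.set i b, s.2.2)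
  | Sum.inr i => (s.1, s.2.1, s.2.2.set i b)

/-- An effective physical adaptation process. In a configuration that is not halted it performs the
logically reversible (injective) operation `next`; if `erased` then names a cell, a logical
erasure of that cell follows. Which cell is erased does not depend on the bit that is lost, so that
a step without erasure is injective and an erasure loses exactly one bit. Every irreversible
operation of the process is such an erasure. The substrates are allowed to coincide physically, so
cells of the execution substrate can be erased as well; all erasures are counted. The process is
given by a program `code` for its one-step behaviour. -/
structure AdaptationProcess where
  code : Nat.Partrec.Code
  halted : Config → Bool
  next : Config → Config
  erased : Config → Option Cell
  code_eval : ∀ s : Config, code.eval (Encodable.encode s) =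
    Part.some (Encodable.encode (halted s, next s, erased s))
  next_injOn : Set.InjOn next {s | halted s = false}
  erased_hasCell : ∀ s k, erased s = some k → s.HasCell k
  erased_overwrite : ∀ s k b, erased s = some k → erased (s.overwrite k b) = some k

/-- The description (source code) of a process, as a binary string. -/
def AdaptationProcess.desc (P : AdaptationProcess) : List Bool :=
  Nat.bits (Encodable.encode P.code)

/-- `P.Run s H t`: started in `s`, the process can halt in `t` after exactly `H` logical erasures.
An erasure overwrites the cell irrespective of its content. The new content `b` is `false` for a
reset to the standard state; a value supplied by the environment is also allowed, so the relation
covers all the physical outcomes of an irreversible bit operation. -/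
inductive AdaptationProcess.Run (P : AdaptationProcess) : Config → ℕ → Config → Prop
  | halt (s : Config) : P.halted s = true → P.Run s 0 s
  | reversible (s : Config) (H : ℕ) (t : Config) : P.halted s = false →
      P.erased (P.next s) = none → P.Run (P.next s) H t → P.Run s H t
  | erase (s : Config) (k : Cell) (b : Bool) (H : ℕ) (t : Config) : P.halted s = false →
      P.erased (P.next s) = some k → P.Run ((P.next s).overwrite k b) H t → P.Run s (H + 1) t

/-! After cancelling `K(σ)` the claim reads `K(σ | D) ≤ H + K(σ | S) + O(1)`. Given `D`, a program
for `σ` can recover the description of the process, simulate the run while reading one program bit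
per erasure (the bit written), and then run a shortest program for `σ` on the resulting `S`. Halting
of the run makes the `H` bits self-delimiting, so this is a prefix machine
(`isPrefixMachine_adaptationMachine`).

The simulation must also know `S₀`, which may be arbitrarily long. The independence hypothesis
removes this obstacle. By `exists_condK_add_lt_prefixK`, every condition with a large enough code
lowers the complexity of every sufficiently complex string by more than `c₀`. Hence either `K(σ)` is
bounded, and the claim is trivial, or `S₀` lies in a fixed finite set. In the latter case `S₀`, and
a program of length at most `c₁` for the description, are built into the machine, and the finitely
many overheads have a common bound.

For the clock effect, enumerate the halting programs of `U` on the empty condition without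
repetition. By Kraft's inequality late stages have small total weight. A condition with code `m`
splits the enumeration: read forwards from `m`, or backwards from `m - 1`, it reaches any late
program after passing only late programs. An online Kraft code on that list shortens the program by
`2L` bits, while announcing `L` costs `L + 1`. -/

open Nat.Partrec (Code)


/-! ### Online Kraft coding by aligned dyadic intervals -/

/-- The number with the given binary digits, most significant digit first. -/
def bitsVal (q : List Bool) : ℕ := q.foldl (fun a b => 2 * a + b.toNat) 0

theorem bitsVal_concat (q : List Bool) (b : Bool) :
    bitsVal (q ++ [b]) = 2 * bitsVal q + b.toNat := by
  simp [bitsVal]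

theorem bitsVal_append (q r : List Bool) :
    ∃ s < 2 ^ r.length, bitsVal (q ++ r) = bitsVal q * 2 ^ r.length + s := by
  induction r using List.reverseRecOn with
  | nil => exact ⟨0, by simp⟩
  | append_singleton r b ih =>
    obtain ⟨s, hs, h⟩ := ih
    refine ⟨2 * s + b.toNat, ?_, ?_⟩
    · have := b.toNat_le
      simp only [List.length_append, List.length_singleton, pow_succ]
      omega
    · rw [← List.append_assoc, bitsVal_concat, h]
      simp only [List.length_append, List.length_singleton, pow_succ]
      ring

theorem exists_bitsVal_eq (n s : ℕ) (hs : s < 2 ^ n) :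
    ∃ q : List Bool, q.length = n ∧ bitsVal q = s := by
  induction n generalizing s with
  | zero => exact ⟨[], by simp [bitsVal]; omega⟩
  | succ n ih =>
    obtain ⟨q, hq, hv⟩ := ih (s / 2) (by rw [pow_succ] at hs; omega)
    refine ⟨q ++ [decide (s % 2 = 1)], by simp [hq], ?_⟩
    rw [bitsVal_concat, hv]
    rcases Nat.mod_two_eq_zero_or_one s with h | h <;> simp [h] <;> omega

/-- The Kraft weight of an optional code word. -/
noncomputable def kraftWeight (o : Option (List Bool)) : ℝ :=
  o.elim 0 fun p => (1 / 2) ^ p.length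

theorem kraftWeight_nonneg (o : Option (List Bool)) : 0 ≤ kraftWeight o := by
  cases o <;> simp [kraftWeight]

/-- The least `s` with `A / 2 ^ l ≤ s / 2 ^ n`. -/
def alignUp (A l n : ℕ) : ℕ := (A * 2 ^ n + 2 ^ l - 1) / 2 ^ l

theorem le_alignUp (A l n : ℕ) : (A : ℝ) / 2 ^ l ≤ alignUp A l n / 2 ^ n := by
  rw [div_le_div_iff₀ (by positivity) (by positivity)]
  have h : A * 2 ^ n ≤ alignUp A l n * 2 ^ l := by
    have h0 : 0 < 2 ^ l := by positivity
    have h1 := Nat.div_add_mod (A * 2 ^ n + 2 ^ l - 1) (2 ^ l)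
    have h2 := Nat.mod_lt (A * 2 ^ n + 2 ^ l - 1) h0
    unfold alignUp
    rw [mul_comm] at h1
    omega
  exact_mod_cast h

theorem alignUp_le (A l n : ℕ) : (alignUp A l n : ℝ) / 2 ^ n ≤ A / 2 ^ l + (1 / 2) ^ n := by
  have h : alignUp A l n * 2 ^ l ≤ A * 2 ^ n + 2 ^ l := by
    have := Nat.div_mul_le_self (A * 2 ^ n + 2 ^ l - 1) (2 ^ l)
    exact this.trans (Nat.sub_le _ _)
  have h' : (alignUp A l n : ℝ) * 2 ^ l ≤ A * 2 ^ n + 2 ^ l := by exact_mod_cast h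
  rw [one_div, inv_pow, ← one_div, div_add_div _ _ (by positivity) (by positivity),
    div_le_div_iff₀ (by positivity) (by positivity)]
  nlinarith [pow_pos (two_pos : (0 : ℝ) < 2) n]

/-- The left end `A / 2 ^ l` of the free part of the unit interval, after the items `g 0`, …,
`g (i - 1)` have been allotted consecutive aligned dyadic intervals. -/
def freeFrom (g : ℕ → Option (List Bool)) (i : ℕ) : ℕ × ℕ :=
  i.rec (0, 0) fun j st =>
    (g j).elim st fun p => (alignUp st.1 st.2 p.length + 1, p.length)

/-- The dyadic interval of an item of length `n` at position `i` is
`[itemStart g i n / 2 ^ n, (itemStart g i n + 1) / 2 ^ n)`. -/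
def itemStart (g : ℕ → Option (List Bool)) (i n : ℕ) : ℕ :=
  alignUp (freeFrom g i).1 (freeFrom g i).2 n

theorem freeFrom_succ_none {g : ℕ → Option (List Bool)} {i : ℕ} (h : g i = none) :
    freeFrom g (i + 1) = freeFrom g i := by
  simp [freeFrom, h]

theorem freeFrom_succ_some {g : ℕ → Option (List Bool)} {i : ℕ} {p : List Bool}
    (h : g i = some p) : freeFrom g (i + 1) = (itemStart g i p.length + 1, p.length) := by
  simp [freeFrom, itemStart, h]

/-- `freeFrom` as a real number. -/
noncomputable def freePos (g : ℕ → Option (List Bool)) (i : ℕ) : ℝ :=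
  (freeFrom g i).1 / 2 ^ (freeFrom g i).2

theorem freePos_succ_some {g : ℕ → Option (List Bool)} {i : ℕ} {p : List Bool}
    (h : g i = some p) :
    freePos g (i + 1) = (itemStart g i p.length + 1) / 2 ^ p.length := by
  simp [freePos, freeFrom_succ_some h]

theorem freePos_le_itemStart (g : ℕ → Option (List Bool)) (i n : ℕ) :
    freePos g i ≤ itemStart g i n / 2 ^ n :=
  le_alignUp _ _ _

theorem freePos_monotone (g : ℕ → Option (List Bool)) : Monotone (freePos g) := by
  refine monotone_nat_of_le_succ fun i => ?_
  rcases h : g i with _ | p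
  · simp [freePos, freeFrom_succ_none h]
  · rw [freePos_succ_some h]
    refine (freePos_le_itemStart g i p.length).trans ?_
    gcongr
    linarith

/-- Alignment skips at most the length of the new interval, so each item uses up at most twice its
weight. -/
theorem freePos_le_sum (g : ℕ → Option (List Bool)) (i : ℕ) :
    freePos g i ≤ 2 * ∑ j ∈ Finset.range i, kraftWeight (g j) := by
  induction i with
  | zero => simp [freePos, freeFrom]
  | succ i ih =>
    rw [Finset.sum_range_succ]
    rcases h : g i with _ | p
    · have : freePos g (i + 1) = freePos g i := by simp [freePos, freeFrom_succ_none h]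
      simpa [this, kraftWeight] using ih
    · rw [freePos_succ_some h, add_div]
      have := alignUp_le (freeFrom g i).1 (freeFrom g i).2 p.length
      have h1 : (1 : ℝ) / 2 ^ p.length = (1 / 2) ^ p.length := by simp
      have h2 : kraftWeight (some p) = (1 / 2) ^ p.length := rfl
      rw [h1, h2]
      change (itemStart g i p.length : ℝ) / _ ≤ freePos g i + _ at this
      linarith

/-- The codeword `q` is the one of the item `p` at position `i`, shortened by `k` bits. -/
def IsItemCode (g : ℕ → Option (List Bool)) (k : ℕ) (q : List Bool) (i : ℕ) (p : List Bool) :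
    Prop :=
  g i = some p ∧ p.length = q.length + k ∧ itemStart g i p.length = bitsVal q

theorem IsItemCode.not_lt_of_prefix {g : ℕ → Option (List Bool)} {k : ℕ} {q q' : List Bool}
    {i i' : ℕ} {p p' : List Bool} (h : IsItemCode g k q i p) (h' : IsItemCode g k q' i' p')
    (hq : q <+: q' ∨ q' <+: q) : ¬ i < i' := by
  intro hi
  obtain ⟨h1, h2, h3⟩ := h
  obtain ⟨h1', h2', h3'⟩ := h'
  -- The interval of the earlier item ends before that of the later one begins. Prefix comparability
  -- of `q` and `q'` would instead make these intervals nested, since both codewords drop the same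
  -- number `k` of leading bits.
  have key : ((bitsVal q : ℝ) + 1) / 2 ^ (q.length + k) ≤ bitsVal q' / 2 ^ (q'.length + k) := by
    rw [← h3, ← h3', ← h2, ← h2', ← freePos_succ_some h1]
    exact (freePos_monotone g hi).trans (freePos_le_itemStart _ _ _)
  rw [div_le_div_iff₀ (by positivity) (by positivity)] at key
  have key' : (bitsVal q + 1) * 2 ^ (q'.length + k) ≤ bitsVal q' * 2 ^ (q.length + k) := by
    exact_mod_cast key
  rcases hq with ⟨r, rfl⟩ | ⟨r, rfl⟩
  · obtain ⟨s, hs, e⟩ := bitsVal_append q r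
    rw [e, List.length_append, show q.length + r.length + k = r.length + (q.length + k) by ring,
      pow_add, ← mul_assoc] at key'
    have := Nat.le_of_mul_le_mul_right key' (by positivity)
    nlinarith
  · obtain ⟨s, hs, e⟩ := bitsVal_append q' r
    rw [e, List.length_append, show q'.length + r.length + k = r.length + (q'.length + k) by ring,
      pow_add 2 r.length, ← mul_assoc (bitsVal q')] at key'
    have := Nat.le_of_mul_le_mul_right key' (by positivity)
    nlinarith

theorem IsItemCode.eq_of_prefix {g : ℕ → Option (List Bool)} {k : ℕ} {q q' : List Bool}
    {i i' : ℕ} {p p' : List Bool} (h : IsItemCode g k q i p) (h' : IsItemCode g k q' i' p')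
    (hq : q <+: q') : q = q' := by
  have h1 := h.not_lt_of_prefix h' (.inl hq)
  have h2 := h'.not_lt_of_prefix h (.inr hq)
  obtain rfl : i = i' := by omega
  obtain rfl : p = p' := Option.some_injective _ (h.1.symm.trans h'.1)
  exact hq.eq_of_length (by have := h.2.1; have := h'.2.1; omega)

/-- The interval of the item lies in `[0, 2⁻ᵏ)`, so the first `k` of the `p.length` binary digits of
its left end vanish and can be dropped. Only the weight up to this item matters, not that of the
whole list. -/
theorem exists_isItemCode {g : ℕ → Option (List Bool)} {i k : ℕ} {p : List Bool}
    (h : g i = some p)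
    (hs : 2 * ∑ j ∈ Finset.range (i + 1), kraftWeight (g j) ≤ (1 / 2) ^ k) :
    ∃ q, IsItemCode g k q i p := by
  have h1 := (freePos_le_sum g (i + 1)).trans hs
  rw [freePos_succ_some h, one_div, inv_pow, ← one_div,
    div_le_div_iff₀ (by positivity) (by positivity), one_mul] at h1
  have h2 : (itemStart g i p.length + 1) * 2 ^ k ≤ 2 ^ p.length := by exact_mod_cast h1
  -- An interval of length `2 ^ (-p.length)` fits below `2⁻ᵏ`.
  have h3 : k ≤ p.length := by
    rw [← Nat.pow_le_pow_iff_right (a := 2) (by norm_num)]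
    exact (Nat.le_mul_of_pos_left _ (Nat.succ_pos _)).trans h2
  obtain ⟨d, hd⟩ := Nat.exists_eq_add_of_le h3
  have h4 : itemStart g i p.length + 1 ≤ 2 ^ d := by
    rw [hd, pow_add, mul_comm (2 ^ k)] at h2
    rw [hd]
    exact Nat.le_of_mul_le_mul_right h2 (by positivity)
  obtain ⟨q, hq, hv⟩ := exists_bitsVal_eq d (itemStart g i p.length) h4
  exact ⟨q, h, by omega, hv.symm⟩

/-! ### Kraft's inequality and small tails -/

/-- **Kraft's inequality** for prefix-free sets of binary strings. -/
theorem sum_kraftWeight_le_one (T : Finset (List Bool))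
    (hT : ∀ p ∈ T, ∀ q ∈ T, p <+: q → p = q) :
    ∑ p ∈ T, kraftWeight (some p) ≤ 1 := by
  -- A code containing the empty word is not uniquely decodable, so McMillan's inequality does not
  -- apply; but prefix-freeness then leaves no other word.
  by_cases h0 : [] ∈ T
  · have : T = {[]} := by
      ext p
      rw [Finset.mem_singleton]
      exact ⟨fun hp => (hT [] h0 p hp List.nil_prefix).symm, fun hp => hp ▸ h0⟩
    simp [this, kraftWeight]
  · have hu : InformationTheory.UniquelyDecodable (T : Set (List Bool)) := by
      intro L₁
      induction L₁ with
      | nil =>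
        intro L₂ _ h2 h
        cases L₂ with
        | nil => rfl
        | cons b L₂ =>
          have hb : b = [] := by simp at h; exact h.1
          exact absurd (h2 b (by simp)) (hb ▸ h0)
      | cons a L₁ ih =>
        intro L₂ h1 h2 h
        cases L₂ with
        | nil =>
          have ha : a = [] := by simp at h; exact h.1
          exact absurd (h1 a (by simp)) (ha ▸ h0)
        | cons b L₂ =>
          simp only [List.flatten_cons] at h
          have hab : a = b := by
            have ha : a <+: b ++ L₂.flatten := ⟨_, h⟩
            have hb : b <+: b ++ L₂.flatten := ⟨_, rfl⟩
            rcases List.prefix_or_prefix_of_prefix ha hb with h' | h'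
            · exact hT a (h1 a (by simp)) b (h2 b (by simp)) h'
            · exact (hT b (h2 b (by simp)) a (h1 a (by simp)) h').symm
          subst hab
          rw [ih L₂ (fun w hw => h1 w (by simp [hw])) (fun w hw => h2 w (by simp [hw]))
            (List.append_cancel_left h)]
    simpa [kraftWeight] using InformationTheory.kraft_mcmillan_inequality hu

/-- The weights of an enumeration without repetition of a prefix-free set are summable. -/
theorem summable_kraftWeight {f : ℕ → Option (List Bool)}
    (hf : ∀ m n p, f m = some p → f n = some p → m = n)
    (hp : ∀ m n p q, f m = some p → f n = some q → p <+: q → p = q) :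
    Summable fun n => kraftWeight (f n) := by
  refine summable_of_sum_le (c := 1) (fun n => kraftWeight_nonneg _) fun u => ?_
  -- Stages without output weigh nothing. Once they are discarded, the default value of `getD` is
  -- never used and the enumeration is injective.
  have h1 : ∑ n ∈ u, kraftWeight (f n) =
      ∑ n ∈ u with (f n).isSome, kraftWeight (some ((f n).getD [])) := by
    rw [Finset.sum_filter]
    refine Finset.sum_congr rfl fun n _ => ?_
    rcases f n with _ | p <;> simp [kraftWeight]
  rw [h1, ← Finset.sum_image (f := fun p => kraftWeight (some p)) (g := fun n => (f n).getD [])]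
  · refine sum_kraftWeight_le_one _ fun p hp' q hq' => ?_
    simp only [Finset.mem_image, Finset.mem_filter, Option.isSome_iff_exists] at hp' hq'
    obtain ⟨m, ⟨_, a, ha⟩, rfl⟩ := hp'
    obtain ⟨n, ⟨_, b, hb⟩, rfl⟩ := hq'
    simpa [ha, hb] using hp m n a b ha hb
  · intro m hm n hn h
    simp only [Finset.coe_filter, Set.mem_ofPred_eq, Option.isSome_iff_exists] at hm hn
    obtain ⟨_, a, ha⟩ := hm
    obtain ⟨_, b, hb⟩ := hn
    simp only [ha, hb, Option.getD_some] at h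
    exact hf m n a ha (h ▸ hb)

/-- The weight of any finite set of late stages is small. -/
theorem exists_sum_kraftWeight_le {f : ℕ → Option (List Bool)}
    (hf : Summable fun n => kraftWeight (f n)) {ε : ℝ} (hε : 0 < ε) :
    ∃ M : ℕ, ∀ u : Finset ℕ, (∀ n ∈ u, M ≤ n) → ∑ n ∈ u, kraftWeight (f n) ≤ ε := by
  obtain ⟨s, hs⟩ := summable_iff_vanishing_norm.1 hf ε hε
  obtain ⟨M, hM⟩ := s.exists_nat_subset_range
  refine ⟨M, fun u hu => (le_abs_self _).trans (hs u ?_).le⟩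
  rw [Finset.disjoint_left]
  intro n hn hn'
  have := Finset.mem_range.1 (hM hn')
  have := hu n hn
  omega

/-! ### The compressing machine and its computability -/

/-- Splits `1ᴸ0q` into `L` and `q`. -/
def unaryHeader (x : List Bool) : Option (ℕ × List Bool) :=
  x.rec none fun b t r => bif b then r.map fun z => (z.1 + 1, z.2) else some (0, t)

theorem unaryHeader_eq_some {x : List Bool} {L : ℕ} {q : List Bool} :
    unaryHeader x = some (L, q) ↔ x = List.replicate L true ++ false :: q := by
  induction x generalizing L with
  | nil => simp [unaryHeader]
  | cons b t ih =>
    cases b with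
    | false =>
      change some (0, t) = _ ↔ _
      cases L with
      | zero => simp
      | succ L => simp [List.replicate_succ]
    | true =>
      change (unaryHeader t).map _ = _ ↔ _
      cases L with
      | zero => simp
      | succ L =>
        rw [List.replicate_succ, List.cons_append, List.cons.injEq, eq_self_iff_true, true_and,
          ← ih]
        simp [Option.map_eq_some_iff]

theorem primrec_unaryHeader : Primrec unaryHeader :=
  Primrec.list_rec Primrec.id (Primrec.const none)
    (Primrec.cond (Primrec.fst.comp Primrec.snd)
      (Primrec.option_map (Primrec.snd.comp (Primrec.snd.comp Primrec.snd))
        ((Primrec.succ.comp (Primrec.fst.comp Primrec.snd)).pair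
          (Primrec.snd.comp Primrec.snd)).to₂)
      (Primrec.option_some.comp
        ((Primrec.const 0).pair (Primrec.fst.comp (Primrec.snd.comp Primrec.snd))))).to₂

theorem primrec_bitsVal : Primrec bitsVal :=
  Primrec.list_foldl Primrec.id (Primrec.const 0)
    (Primrec.nat_add.comp
      (Primrec.nat_mul.comp (Primrec.const 2) (Primrec.fst.comp Primrec.snd))
      ((Primrec.dom_bool Bool.toNat).comp (Primrec.snd.comp Primrec.snd))).to₂

theorem Primrec.nat_pow : Primrec₂ ((· ^ ·) : ℕ → ℕ → ℕ) :=
  Primrec₂.unpaired'.1 Nat.Primrec.pow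

theorem primrec_alignUp : Primrec fun a : ℕ × ℕ × ℕ => alignUp a.1 a.2.1 a.2.2 :=
  Primrec.nat_div.comp
    (Primrec.nat_sub.comp
      (Primrec.nat_add.comp
        (Primrec.nat_mul.comp Primrec.fst
          (Primrec.nat_pow.comp (Primrec.const 2) (Primrec.snd.comp Primrec.snd)))
        (Primrec.nat_pow.comp (Primrec.const 2) (Primrec.fst.comp Primrec.snd)))
      (Primrec.const 1))
    (Primrec.nat_pow.comp (Primrec.const 2) (Primrec.fst.comp Primrec.snd))

section fun_form

variable {α : Type*} [Primcodable α]

theorem Computable.fun_alignUp {A l n : α → ℕ} (hA : Computable A) (hl : Computable l)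
    (hn : Computable n) : Computable fun a => alignUp (A a) (l a) (n a) :=
  primrec_alignUp.to_comp.comp (hA.pair (hl.pair hn))

theorem Computable.fun_add {m n : α → ℕ} (hm : Computable m) (hn : Computable n) :
    Computable fun a => m a + n a :=
  Primrec.nat_add.to_comp.comp hm hn

theorem Computable.fun_mul {m n : α → ℕ} (hm : Computable m) (hn : Computable n) :
    Computable fun a => m a * n a :=
  Primrec.nat_mul.to_comp.comp hm hn

theorem Computable.fun_sub {m n : α → ℕ} (hm : Computable m) (hn : Computable n) :
    Computable fun a => m a - n a :=
  Primrec.nat_sub.to_comp.comp hm hn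

theorem Computable.fun_beq {m n : α → ℕ} (hm : Computable m) (hn : Computable n) :
    Computable fun a => m a == n a :=
  Primrec.beq.to_comp.comp hm hn

theorem Computable.fun_and {m n : α → Bool} (hm : Computable m) (hn : Computable n) :
    Computable fun a => m a && n a :=
  Primrec.and.to_comp.comp hm hn

end fun_form

section coder

variable {g : List Bool → ℕ → Option (List Bool)}

theorem computable_freeFrom (hg : Computable₂ g) :
    Computable₂ fun y i => freeFrom (g y) i := by
  have hst : Computable fun a : ((List Bool × ℕ) × ℕ × ℕ × ℕ) × List Bool => a.1.2.2 :=
    Computable.snd.comp (Computable.snd.comp Computable.fst)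
  have hl : Computable fun a : ((List Bool × ℕ) × ℕ × ℕ × ℕ) × List Bool => a.2.length :=
    Computable.list_length.comp Computable.snd
  have hnext := ((((Computable.fst.comp hst).fun_alignUp (Computable.snd.comp hst) hl).fun_add
    (Computable.const 1)).pair hl).to₂
  have hitem : Computable fun b : (List Bool × ℕ) × ℕ × ℕ × ℕ => g b.1.1 b.2.1 :=
    hg.comp (Computable.fst.comp Computable.fst) (Computable.fst.comp Computable.snd)
  have hstep := (Computable.option_casesOn hitem (Computable.snd.comp Computable.snd) hnext).to₂
  refine (Computable.nat_rec Computable.snd (Computable.const (0, 0)) hstep).of_eq fun a => ?_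
  unfold freeFrom
  congr 1
  funext j st
  dsimp only
  cases g a.1 j <;> rfl

/-- The item at position `i`, provided that `q` is its codeword shortened by `k` bits. -/
def itemIfCode (g : ℕ → Option (List Bool)) (k : ℕ) (q : List Bool) (i : ℕ) :
    Option (List Bool) :=
  (g i).bind fun p =>
    bif p.length == q.length + k && itemStart g i p.length == bitsVal q then some p else none

theorem itemIfCode_eq_some {g : ℕ → Option (List Bool)} {k : ℕ} {q : List Bool} {i : ℕ}
    {p : List Bool} : itemIfCode g k q i = some p ↔ IsItemCode g k q i p := by
  simp only [itemIfCode, Option.bind_eq_some_iff, IsItemCode, cond_eq_ite, Bool.and_eq_true,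
    beq_iff_eq]
  constructor
  · rintro ⟨p', h, h'⟩
    split_ifs at h' with hc
    cases h'
    exact ⟨h, hc⟩
  · rintro ⟨h, hc⟩
    exact ⟨p, h, by rw [if_pos hc]⟩

/-- The program with codeword `q` on condition `y`. -/
def decodeItem (g : List Bool → ℕ → Option (List Bool)) (y : List Bool) (k : ℕ)
    (q : List Bool) : Part (List Bool) :=
  Nat.rfindOpt (itemIfCode (g y) k q)

theorem isItemCode_of_mem_decodeItem {y : List Bool} {k : ℕ} {q p : List Bool}
    (h : p ∈ decodeItem g y k q) : ∃ i, IsItemCode (g y) k q i p := by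
  obtain ⟨i, hi⟩ := Nat.rfindOpt_spec h
  exact ⟨i, itemIfCode_eq_some.1 hi⟩

/-- The search may stop at any position matching `q`, but disjointness of the intervals leaves only
one. -/
theorem IsItemCode.mem_decodeItem {y : List Bool} {k : ℕ} {q : List Bool} {i : ℕ}
    {p : List Bool} (h : IsItemCode (g y) k q i p) : p ∈ decodeItem g y k q := by
  have hd : (decodeItem g y k q).Dom :=
    Nat.rfindOpt_dom.2 ⟨i, p, itemIfCode_eq_some.2 h⟩
  obtain ⟨p', hp'⟩ := Part.dom_iff_mem.1 hd
  obtain ⟨i', h'⟩ := isItemCode_of_mem_decodeItem hp'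
  have h1 := h.not_lt_of_prefix h' (.inl List.prefix_rfl)
  have h2 := h'.not_lt_of_prefix h (.inl List.prefix_rfl)
  obtain rfl : i = i' := by omega
  obtain rfl : p = p' := Option.some_injective _ (h.1.symm.trans h'.1)
  exact hp'

theorem computable_itemIfCode (hg : Computable₂ g) :
    Computable fun a : (List Bool × ℕ × List Bool) × ℕ =>
      itemIfCode (g a.1.1) a.1.2.1 a.1.2.2 a.2 := by
  have hy : Computable fun a : ((List Bool × ℕ × List Bool) × ℕ) × List Bool => a.1.1.1 :=
    Computable.fst.comp (Computable.fst.comp Computable.fst)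
  have hk : Computable fun a : ((List Bool × ℕ × List Bool) × ℕ) × List Bool => a.1.1.2.1 :=
    Computable.fst.comp (Computable.snd.comp (Computable.fst.comp Computable.fst))
  have hq : Computable fun a : ((List Bool × ℕ × List Bool) × ℕ) × List Bool => a.1.1.2.2 :=
    Computable.snd.comp (Computable.snd.comp (Computable.fst.comp Computable.fst))
  have hi : Computable fun a : ((List Bool × ℕ × List Bool) × ℕ) × List Bool => a.1.2 :=
    Computable.snd.comp Computable.fst
  have hp : Computable fun a : ((List Bool × ℕ × List Bool) × ℕ) × List Bool => a.2.length :=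
    Computable.list_length.comp Computable.snd
  have hfree := (computable_freeFrom hg).comp hy hi
  have hstart := (Computable.fst.comp hfree).fun_alignUp (Computable.snd.comp hfree) hp
  have hcode := Computable.cond
    ((hp.fun_beq ((Computable.list_length.comp hq).fun_add hk)).fun_and
      (hstart.fun_beq (primrec_bitsVal.to_comp.comp hq)))
    (Computable.option_some.comp Computable.snd) (Computable.const none)
  exact Computable.option_bind
    (hg.comp (Computable.fst.comp Computable.fst) Computable.snd) hcode.to₂

theorem Partrec.fun_decodeItem {α : Type*} [Primcodable α] (hg : Computable₂ g)
    {y : α → List Bool} {k : α → ℕ} {q : α → List Bool} (hy : Computable y) (hk : Computable k)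
    (hq : Computable q) : Partrec fun a => decodeItem g (y a) (k a) (q a) := by
  have h : Partrec fun a : List Bool × ℕ × List Bool => decodeItem g a.1 a.2.1 a.2.2 :=
    Partrec.rfindOpt (computable_itemIfCode hg).to₂
  exact h.comp (hy.pair (hk.pair hq))

/-- The machine that, on the program `1ᴸ0q`, decodes `q` as a codeword shortened by `2L` bits and
runs `U` with the empty condition on the result. -/
def compressor (U : List Bool → List Bool →. List Bool) (g : List Bool → ℕ → Option (List Bool))
    (x y : List Bool) : Part (List Bool) :=
  (unaryHeader x : Part (ℕ × List Bool)).bind fun z =>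
    (decodeItem g y (2 * z.1) z.2).bind fun p => U p []

theorem partrec_compressor {U : List Bool → List Bool →. List Bool}
    (hU : Partrec₂ U) (hg : Computable₂ g) : Partrec₂ (compressor U g) := by
  have hz : Computable fun a : (List Bool × List Bool) × ℕ × List Bool => 2 * a.2.1 :=
    (Computable.const 2).fun_mul (Computable.fst.comp Computable.snd)
  have hdec : Partrec fun a : (List Bool × List Bool) × ℕ × List Bool =>
      decodeItem g a.1.2 (2 * a.2.1) a.2.2 :=
    Partrec.fun_decodeItem hg (Computable.snd.comp Computable.fst) hz
      (Computable.snd.comp Computable.snd)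
  have hrun : Partrec₂ fun (_ : (List Bool × List Bool) × ℕ × List Bool) p => U p [] :=
    hU.comp Computable.snd (Computable.const [])
  have hhead : Partrec fun a : List Bool × List Bool =>
      (unaryHeader a.1 : Part (ℕ × List Bool)) :=
    Computable.ofOption (primrec_unaryHeader.to_comp.comp Computable.fst)
  exact hhead.bind (hdec.bind hrun).to₂

/-- The unary header is self-delimiting, so comparable programs share `L`; the remaining codewords
then belong to one list with one shortening. No bound on the weights of the list is needed. -/
theorem prefix_free_compressor {U : List Bool → List Bool →. List Bool} {y x x' : List Bool}
    (hx : (compressor U g x y).Dom) (hx' : (compressor U g x' y).Dom) (hxx : x <+: x') :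
    x = x' := by
  have key : ∀ w, (compressor U g w y).Dom → ∃ L q i p,
      w = List.replicate L true ++ false :: q ∧ IsItemCode (g y) (2 * L) q i p := by
    intro w hw
    obtain ⟨s, hs⟩ := Part.dom_iff_mem.1 hw
    simp only [compressor, Part.mem_bind_iff, Part.mem_coe] at hs
    obtain ⟨⟨L, q⟩, hL, p, hp, -⟩ := hs
    obtain ⟨i, hi⟩ := isItemCode_of_mem_decodeItem hp
    exact ⟨L, q, i, p, unaryHeader_eq_some.1 hL, hi⟩
  obtain ⟨L, q, i, p, rfl, h⟩ := key x hx
  obtain ⟨L', q', i', p', rfl, h'⟩ := key x' hx'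
  obtain ⟨r, hr⟩ := hxx
  have e : unaryHeader (List.replicate L' true ++ false :: q') = some (L', q') :=
    unaryHeader_eq_some.2 rfl
  have e' : unaryHeader (List.replicate L true ++ false :: q ++ r) = some (L, q ++ r) :=
    unaryHeader_eq_some.2 (by simp)
  rw [← hr, e'] at e
  simp only [Option.some.injEq, Prod.mk.injEq] at e
  obtain ⟨rfl, rfl⟩ := e
  rw [← h.eq_of_prefix h' ⟨r, rfl⟩]

theorem isPrefixMachine_compressor {U : List Bool → List Bool →. List Bool}
    (hU : IsPrefixMachine U) (hg : Computable₂ g) : IsPrefixMachine (compressor U g) where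
  partrec := partrec_compressor hU.partrec hg
  prefix_free _ _ _ := prefix_free_compressor

/-- The codeword saves `2 * L` bits and the header costs `L + 1`, a net gain of `L - 1`. -/
theorem exists_mem_compressor {U : List Bool → List Bool →. List Bool}
    {y x p : List Bool} {i L : ℕ} (hp : g y i = some p) (hx : x ∈ U p [])
    (hs : 2 * ∑ j ∈ Finset.range (i + 1), kraftWeight (g y j) ≤ (1 / 2) ^ (2 * L)) :
    ∃ q, q.length + L = p.length + 1 ∧ x ∈ compressor U g q y := by
  obtain ⟨q, hq⟩ := exists_isItemCode hp hs
  refine ⟨List.replicate L true ++ false :: q, ?_, ?_⟩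
  · have := hq.2.1
    simp
    omega
  · simp only [compressor, Part.mem_bind_iff, Part.mem_coe]
    exact ⟨(L, q), unaryHeader_eq_some.2 rfl, p, hq.mem_decodeItem, hx⟩

end coder

/-! ### Enumeration of a domain without repetition -/

/-- The domain of a partial recursive function can be enumerated without repetition. -/
theorem exists_computable_enumeration {α β : Type*} [Primcodable α] [Primcodable β] {f : α →. β}
    (hf : Partrec f) :
    ∃ e : ℕ → Option α, Computable e ∧ (∀ a, (f a).Dom ↔ ∃ n, e n = some a) ∧
      ∀ m n a, e m = some a → e n = some a → m = n := by
  obtain ⟨c, hc⟩ := Code.exists_code.1 hf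
  have hdom : ∀ a, (f a).Dom ↔ ∃ t, (c.evaln t (Encodable.encode a)).isSome := by
    intro a
    have h1 : (f a).Dom ↔ (c.eval (Encodable.encode a)).Dom := by
      simp [hc, Part.dom_iff_mem]
    rw [h1, Part.dom_iff_mem]
    simp only [Code.evaln_complete, Option.isSome_iff_exists, Option.mem_def]
    exact exists_comm
  have hmono : ∀ {s t a}, s ≤ t → (c.evaln s a).isSome → (c.evaln t a).isSome := by
    intro s t a hst h
    obtain ⟨x, hx⟩ := Option.isSome_iff_exists.1 h
    exact Option.isSome_iff_exists.2 ⟨x, Code.evaln_mono hst hx⟩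
  -- Stage `n` codes an input and a time bound `t`. The input is emitted only if its computation
  -- succeeds with bound `t + 1` but not with `t`, which by monotonicity happens for one `t` at
  -- most; `decode₂` makes the code of the input unique.
  let e : ℕ → Option α := fun n => (Encodable.decode₂ α n.unpair.1).bind fun a =>
    bif (c.evaln (n.unpair.2 + 1) (Encodable.encode a)).isSome &&
      !(c.evaln n.unpair.2 (Encodable.encode a)).isSome then some a else none
  have he : ∀ n a, e n = some a ↔ Encodable.decode₂ α n.unpair.1 = some a ∧
      (c.evaln (n.unpair.2 + 1) (Encodable.encode a)).isSome ∧
      ¬ (c.evaln n.unpair.2 (Encodable.encode a)).isSome := by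
    intro n a
    simp only [e, Option.bind_eq_some_iff, cond_eq_ite, Bool.and_eq_true, Bool.not_eq_true']
    constructor
    · rintro ⟨b, h, h'⟩
      split_ifs at h' with hb
      cases h'
      exact ⟨h, hb.1, by simp [hb.2]⟩
    · rintro ⟨h, h1, h2⟩
      exact ⟨a, h, by rw [if_pos ⟨h1, by simpa using h2⟩]⟩
  refine ⟨e, ?_, ?_, ?_⟩
  · have hn : Computable fun z : ℕ × α => z.1.unpair.2 :=
      Computable.snd.comp (Computable.unpair.comp Computable.fst)
    have hrun : ∀ {t : ℕ × α → ℕ}, Computable t →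
        Computable fun z => (c.evaln (t z) (Encodable.encode z.2)).isSome := fun ht =>
      Primrec.option_isSome.to_comp.comp (Code.primrec_evaln.to_comp.comp
        ((ht.pair (Computable.const c)).pair (Computable.encode.comp Computable.snd)))
    exact Computable.option_bind
      (Primrec.decode₂.to_comp.comp (Computable.fst.comp Computable.unpair))
      (Computable.cond ((hrun (hn.fun_add (Computable.const 1))).fun_and
        (Primrec.not.to_comp.comp (hrun hn)))
        (Computable.option_some.comp Computable.snd) (Computable.const none)).to₂
  · intro a
    rw [hdom]
    constructor
    · intro h
      classical
      have h1 := Nat.find_spec h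
      -- Nothing succeeds with bound `0`, so the least successful bound has a predecessor.
      have h0 : Nat.find h ≠ 0 := by
        intro h0
        rw [h0] at h1
        simp [Code.evaln] at h1
      refine ⟨Nat.pair (Encodable.encode a) (Nat.find h - 1), (he _ _).2 ?_⟩
      rw [Nat.unpair_pair]
      exact ⟨Encodable.decode₂_encode a, by rwa [Nat.sub_add_cancel (Nat.pos_of_ne_zero h0)],
        Nat.find_min h (Nat.sub_lt (Nat.pos_of_ne_zero h0) one_pos)⟩
    · rintro ⟨n, hn⟩
      exact ⟨_, ((he n a).1 hn).2.1⟩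
  · intro m n a hm hn
    obtain ⟨hm1, hm2, hm3⟩ := (he m a).1 hm
    obtain ⟨hn1, hn2, hn3⟩ := (he n a).1 hn
    have h2 : m.unpair.2 = n.unpair.2 := by
      rcases lt_trichotomy m.unpair.2 n.unpair.2 with h | h | h
      · exact absurd (hmono h hm2) hn3
      · exact h
      · exact absurd (hmono h hn2) hm3
    have h1 : m.unpair.1 = n.unpair.1 :=
      (Encodable.mem_decode₂.1 hm1).symm.trans (Encodable.mem_decode₂.1 hn1)
    rw [← Nat.pair_unpair m, ← Nat.pair_unpair n, h1, h2]

/-! ### Simulation of an adaptation process -/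

/-- The program with the given source code. -/
def codeOfBits (d : List Bool) : Code :=
  Denumerable.ofNat Code (d.foldr Nat.bit 0)

theorem foldr_bit_bits (n : ℕ) : n.bits.foldr Nat.bit 0 = n := by
  induction n using Nat.binaryRec' with
  | zero => simp
  | bit b n h ih => rw [Nat.bits_append_bit _ _ h, List.foldr_cons, ih]

theorem AdaptationProcess.codeOfBits_desc (P : AdaptationProcess) :
    codeOfBits P.desc = P.code := by
  rw [codeOfBits, AdaptationProcess.desc, foldr_bit_bits, Denumerable.ofNat_encode]

theorem computable_codeOfBits : Computable codeOfBits := by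
  have hbit : Primrec fun z : List Bool × Bool × ℕ => Nat.bit z.2.1 z.2.2 := by
    refine (Primrec.cond (Primrec.fst.comp Primrec.snd)
      (Primrec.nat_double_succ.comp (Primrec.snd.comp Primrec.snd))
      (Primrec.nat_double.comp (Primrec.snd.comp Primrec.snd))).of_eq fun z => ?_
    rcases z with ⟨_, _ | _, n⟩ <;> rfl
  exact (Computable.ofNat Code).comp
    (Primrec.list_foldr Primrec.id (Primrec.const 0) hbit.to₂).to_comp

theorem computable_overwrite :
    Computable fun a : Config × Cell × Bool => a.1.overwrite a.2.1 a.2.2 := by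
  have hs : Primrec fun z : (Config × Cell × Bool) × ℕ => z.1.1 := Primrec.fst.comp Primrec.fst
  have hb : Primrec fun z : (Config × Cell × Bool) × ℕ => z.1.2.2 :=
    Primrec.snd.comp (Primrec.snd.comp Primrec.fst)
  have hsub : Primrec fun z : (Config × Cell × Bool) × ℕ => z.1.1.2.1 :=
    Primrec.fst.comp (Primrec.snd.comp hs)
  have hmem : Primrec fun z : (Config × Cell × Bool) × ℕ => z.1.1.2.2 :=
    Primrec.snd.comp (Primrec.snd.comp hs)
  have h1 := (Primrec.fst.comp hs).pair
    ((Primrec.list_set.comp hsub (Primrec.snd.pair hb)).pair hmem)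
  have h2 := (Primrec.fst.comp hs).pair
    (hsub.pair (Primrec.list_set.comp hmem (Primrec.snd.pair hb)))
  refine ((Primrec.sumCasesOn (Primrec.fst.comp Primrec.snd) h1.to₂ h2.to₂).of_eq
    fun a => ?_).to_comp
  obtain ⟨s, k | k, b⟩ := a <;> rfl

theorem Computable.fun_overwrite {α : Type*} [Primcodable α] {s : α → Config} {k : α → Cell}
    {b : α → Bool} (hs : Computable s) (hk : Computable k) (hb : Computable b) :
    Computable fun a => (s a).overwrite (k a) (b a) :=
  computable_overwrite.comp (hs.pair (hk.pair hb))

/-- The state of the simulation of a process: its program, the current configuration, and the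
erasure outcomes that are still to be consumed. -/
abbrev SimState : Type := Code × Config × List Bool

/-- The effect of one step with result `o`: an erasure consumes one outcome. -/
def simAct (a : SimState) (o : Bool × Config × Option Cell) :
    Option ((List Bool × List Bool) ⊕ SimState) :=
  bif o.1 then some (Sum.inl (a.2.1.2.1, a.2.2))
  else Option.casesOn (motive := fun _ => Option ((List Bool × List Bool) ⊕ SimState)) o.2.2
    (some (Sum.inr (a.1, o.2.1, a.2.2))) fun k =>
      a.2.2.head?.map fun b => Sum.inr (a.1, o.2.1.overwrite k b, a.2.2.tail)

/-- The one-step behaviour in the configuration `s` according to the program `c`. -/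
def stepInfo (c : Code) (s : Config) : Part (Bool × Config × Option Cell) :=
  (c.eval (Encodable.encode s)).bind fun v =>
    ((Encodable.decode v : Option (Bool × Config × Option Cell)) :
      Part (Bool × Config × Option Cell))

/-- One step of the simulation. It ends with the content of the execution substrate and the unused
outcomes. -/
def simStep : SimState →. (List Bool × List Bool) ⊕ SimState := fun a =>
  -- The second evaluation is needed because the erased cell is determined by the configuration
  -- after the reversible operation.
  (stepInfo a.1 a.2.1).bind fun o => (stepInfo a.1 o.2.1).bind fun o' =>
    (simAct a (o.1, o.2.1, o'.2.2) : Part ((List Bool × List Bool) ⊕ SimState))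

theorem computable_simAct : Computable₂ simAct := by
  have hhalt : Computable fun z : SimState × Bool × Config × Option Cell => z.2.1 :=
    Computable.fst.comp Computable.snd
  have hcell : Computable fun z : SimState × Bool × Config × Option Cell => z.2.2.2 :=
    Computable.snd.comp (Computable.snd.comp Computable.snd)
  have hnext : Computable fun z : SimState × Bool × Config × Option Cell => z.2.2.1 :=
    Computable.fst.comp (Computable.snd.comp Computable.snd)
  have hcode : Computable fun z : SimState × Bool × Config × Option Cell => z.1.1 :=
    Computable.fst.comp Computable.fst
  have hsub : Computable fun z : SimState × Bool × Config × Option Cell => z.1.2.1.2.1 :=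
    Computable.fst.comp (Computable.snd.comp
      (Computable.fst.comp (Computable.snd.comp Computable.fst)))
  have hbits : Computable fun z : SimState × Bool × Config × Option Cell => z.1.2.2 :=
    Computable.snd.comp (Computable.snd.comp Computable.fst)
  have hcode' : Computable fun w : ((SimState × Bool × Config × Option Cell) × Cell) × Bool =>
      w.1.1.1.1 := hcode.comp (Computable.fst.comp Computable.fst)
  have hnext' : Computable fun w : ((SimState × Bool × Config × Option Cell) × Cell) × Bool =>
      w.1.1.2.2.1 := hnext.comp (Computable.fst.comp Computable.fst)
  have hbits' : Computable fun w : ((SimState × Bool × Config × Option Cell) × Cell) × Bool =>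
      w.1.1.1.2.2 := hbits.comp (Computable.fst.comp Computable.fst)
  have hover : Computable fun w : ((SimState × Bool × Config × Option Cell) × Cell) × Bool =>
      w.1.1.2.2.1.overwrite w.1.2 w.2 :=
    hnext'.fun_overwrite (Computable.snd.comp Computable.fst) Computable.snd
  have htail : Computable fun w : ((SimState × Bool × Config × Option Cell) × Cell) × Bool =>
      w.1.1.1.2.2.tail := Primrec.list_tail.to_comp.comp hbits'
  have hhead : Computable fun w : (SimState × Bool × Config × Option Cell) × Cell =>
      w.1.1.2.2.head? := Primrec.list_head?.to_comp.comp (hbits.comp Computable.fst)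
  have hgo : Computable₂ fun (w : (SimState × Bool × Config × Option Cell) × Cell) (b : Bool) =>
      (Sum.inr (w.1.1.1, w.1.2.2.1.overwrite w.2 b, w.1.1.2.2.tail) :
        (List Bool × List Bool) ⊕ SimState) :=
    (Computable.sumInr.comp (hcode'.pair (hover.pair htail))).to₂
  have herase : Computable₂ fun (z : SimState × Bool × Config × Option Cell) (k : Cell) =>
      z.1.2.2.head?.map fun b => (Sum.inr (z.1.1, z.2.2.1.overwrite k b, z.1.2.2.tail) :
        (List Bool × List Bool) ⊕ SimState) :=
    (Computable.option_map hhead hgo).to₂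
  have hrev : Computable fun z : SimState × Bool × Config × Option Cell =>
      some (Sum.inr (z.1.1, z.2.2.1, z.1.2.2) : (List Bool × List Bool) ⊕ SimState) :=
    Computable.option_some.comp (Computable.sumInr.comp (hcode.pair (hnext.pair hbits)))
  have hhalted : Computable fun z : SimState × Bool × Config × Option Cell =>
      some (Sum.inl (z.1.2.1.2.1, z.1.2.2) : (List Bool × List Bool) ⊕ SimState) :=
    Computable.option_some.comp (Computable.sumInl.comp (hsub.pair hbits))
  exact Computable.cond hhalt hhalted (Computable.option_casesOn hcell hrev herase)

theorem partrec_stepInfo : Partrec₂ stepInfo := by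
  have heval : Partrec fun a : Code × Config => a.1.eval (Encodable.encode a.2) :=
    Code.eval_part.comp Computable.fst (Computable.encode.comp Computable.snd)
  have hdec : Partrec fun z : (Code × Config) × ℕ =>
      ((Encodable.decode z.2 : Option (Bool × Config × Option Cell)) :
        Part (Bool × Config × Option Cell)) :=
    Computable.ofOption (Computable.decode.comp Computable.snd)
  exact heval.bind hdec.to₂

theorem partrec_simStep : Partrec simStep := by
  have h1 : Partrec fun a : SimState => stepInfo a.1 a.2.1 :=
    partrec_stepInfo.comp Computable.fst (Computable.fst.comp Computable.snd)
  have h2 : Partrec fun z : SimState × Bool × Config × Option Cell =>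
      stepInfo z.1.1 z.2.2.1 :=
    partrec_stepInfo.comp (Computable.fst.comp Computable.fst)
      (Computable.fst.comp (Computable.snd.comp Computable.snd))
  have ho : Computable fun z : (SimState × Bool × Config × Option Cell) ×
      Bool × Config × Option Cell => (z.1.2.1, z.1.2.2.1, z.2.2.2) :=
    (Computable.fst.comp (Computable.snd.comp Computable.fst)).pair
      ((Computable.fst.comp (Computable.snd.comp (Computable.snd.comp Computable.fst))).pair
        (Computable.snd.comp (Computable.snd.comp Computable.snd)))
  have h3 : Partrec fun z : (SimState × Bool × Config × Option Cell) ×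
      Bool × Config × Option Cell => (simAct z.1.1 (z.1.2.1, z.1.2.2.1, z.2.2.2) :
        Part ((List Bool × List Bool) ⊕ SimState)) :=
    Computable.ofOption (computable_simAct.comp (Computable.fst.comp Computable.fst) ho)
  exact h1.bind (h2.bind h3.to₂).to₂

theorem AdaptationProcess.stepInfo_code (P : AdaptationProcess) (s : Config) :
    stepInfo P.code s = Part.some (P.halted s, P.next s, P.erased s) := by
  rw [stepInfo, P.code_eval, Part.bind_some, Encodable.encodek]
  rfl

theorem AdaptationProcess.simStep_code (P : AdaptationProcess) (s : Config) (x : List Bool) :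
    simStep (P.code, s, x) =
      (simAct (P.code, s, x) (P.halted s, P.next s, P.erased (P.next s)) : Part _) := by
  simp only [simStep, P.stepInfo_code, Part.bind_some]

theorem simAct_append_inl {c : Code} {s : Config} {x z : List Bool}
    {o : Bool × Config × Option Cell} {t : List Bool × List Bool}
    (h : simAct (c, s, x) o = some (Sum.inl t)) :
    simAct (c, s, x ++ z) o = some (Sum.inl (t.1, t.2 ++ z)) := by
  obtain ⟨_ | _, n, _ | k⟩ := o
  · simp [simAct] at h
  · cases x <;> simp [simAct] at h
  · simp only [simAct, cond_true, Option.some.injEq, Sum.inl.injEq] at h ⊢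
    subst h; rfl
  · simp only [simAct, cond_true, Option.some.injEq, Sum.inl.injEq] at h ⊢
    subst h; rfl

theorem simAct_append_inr {c : Code} {s : Config} {x z : List Bool}
    {o : Bool × Config × Option Cell} {a : SimState}
    (h : simAct (c, s, x) o = some (Sum.inr a)) :
    simAct (c, s, x ++ z) o = some (Sum.inr (a.1, a.2.1, a.2.2 ++ z)) := by
  obtain ⟨_ | _, n, _ | k⟩ := o
  · simp only [simAct, cond_false, Option.some.injEq, Sum.inr.injEq] at h ⊢
    subst h; rfl
  · cases x with
    | nil => simp [simAct] at h
    | cons b x =>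
      simp only [simAct, cond_false, List.head?_cons, Option.map_some, Option.some.injEq,
        Sum.inr.injEq, List.cons_append, List.tail_cons] at h ⊢
      subst h; rfl
  · simp [simAct] at h
  · simp [simAct] at h

theorem mem_simStep {a : SimState} {r : (List Bool × List Bool) ⊕ SimState} :
    r ∈ simStep a ↔ ∃ o ∈ stepInfo a.1 a.2.1, ∃ o' ∈ stepInfo a.1 o.2.1,
      simAct a (o.1, o.2.1, o'.2.2) = some r := by
  simp only [simStep, Part.mem_bind_iff, Part.mem_coe, Option.mem_def]

/-- Outcomes that are not consumed do not influence the simulation. -/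
theorem fix_simStep_append {a : SimState} {t : List Bool × List Bool} (z : List Bool)
    (h : t ∈ PFun.fix simStep a) :
    (t.1, t.2 ++ z) ∈ PFun.fix simStep (a.1, a.2.1, a.2.2 ++ z) := by
  refine PFun.fixInduction' (C := fun a => (t.1, t.2 ++ z) ∈
    PFun.fix simStep (a.1, a.2.1, a.2.2 ++ z)) h ?_ ?_
  · rintro ⟨c, s, x⟩ hs
    obtain ⟨o, ho, o', ho', hr⟩ := mem_simStep.1 hs
    exact PFun.fix_stop (mem_simStep.2 ⟨o, ho, o', ho', simAct_append_inl hr⟩)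
  · rintro ⟨c, s, x⟩ a'' _ hs ih
    obtain ⟨o, ho, o', ho', hr⟩ := mem_simStep.1 hs
    have hr' := simAct_append_inr (z := z) hr
    have hm : Sum.inr (a''.1, a''.2.1, a''.2.2 ++ z) ∈ simStep (c, s, x ++ z) :=
      mem_simStep.2 ⟨o, ho, o', ho', hr'⟩
    change _ ∈ PFun.fix simStep (c, s, x ++ z)
    rw [PFun.fix_fwd_eq hm]
    exact ih

/-- A run with `H` erasures is simulated with the help of `H` bits. -/
theorem AdaptationProcess.Run.exists_fix_simStep {P : AdaptationProcess} {s t : Config} {H : ℕ}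
    (h : P.Run s H t) : ∃ w : List Bool, w.length = H ∧
      ∀ z, (t.2.1, z) ∈ PFun.fix simStep (P.code, s, w ++ z) := by
  induction h with
  | halt s hs =>
    refine ⟨[], rfl, fun z => PFun.fix_stop ?_⟩
    simp [P.simStep_code, simAct, hs]
  | reversible s H t hs he _ ih =>
    obtain ⟨w, hw, hz⟩ := ih
    refine ⟨w, hw, fun z => ?_⟩
    rw [PFun.fix_fwd_eq (a' := (P.code, P.next s, w ++ z))]
    · exact hz z
    · simp [P.simStep_code, simAct, hs, he]
  | erase s k b H t hs he _ ih =>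
    obtain ⟨w, hw, hz⟩ := ih
    refine ⟨b :: w, by simp [hw], fun z => ?_⟩
    rw [PFun.fix_fwd_eq (a' := (P.code, (P.next s).overwrite k b, w ++ z))]
    · exact hz z
    · simp [P.simStep_code, simAct, hs, he]

/-- The machine that runs `U` on `r` to obtain the description of a process, simulates this process
on the execution substrate content `S₀` and the condition, reading the outcomes of the erasures
from the program, and finally runs `U` on the rest of the program with the resulting content of
the execution substrate as condition. -/
def adaptationMachine (U : List Bool → List Bool →. List Bool) (r S₀ x y : List Bool) :
    Part (List Bool) :=
  (U r y).bind fun d => (PFun.fix simStep (codeOfBits d, (0, S₀, y), x)).bind fun t => U t.2 t.1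

theorem isPrefixMachine_adaptationMachine {U : List Bool → List Bool →. List Bool}
    (hU : IsPrefixMachine U) (r S₀ : List Bool) :
    IsPrefixMachine (adaptationMachine U r S₀) where
  partrec := by
    have h1 : Partrec fun a : List Bool × List Bool => U r a.2 :=
      hU.partrec.comp (Computable.const r) Computable.snd
    have hst : Computable fun z : (List Bool × List Bool) × List Bool =>
        ((codeOfBits z.2, (0, S₀, z.1.2), z.1.1) : SimState) :=
      (computable_codeOfBits.comp Computable.snd).pair
        (((Computable.const 0).pair ((Computable.const S₀).pair
          (Computable.snd.comp Computable.fst))).pair (Computable.fst.comp Computable.fst))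
    have h2 : Partrec fun z : (List Bool × List Bool) × List Bool =>
        PFun.fix simStep (codeOfBits z.2, (0, S₀, z.1.2), z.1.1) :=
      partrec_simStep.fix.comp hst
    have h3 : Partrec fun z : ((List Bool × List Bool) × List Bool) × List Bool × List Bool =>
        U z.2.2 z.2.1 :=
      hU.partrec.comp (Computable.snd.comp Computable.snd) (Computable.fst.comp Computable.snd)
    exact h1.bind (h2.bind h3.to₂).to₂
  -- If `q = p ++ z`, both simulations consume the same bits and reach the same substrate content,
  -- leaving `t.2` and `t.2 ++ z` to `U` under one condition. Prefix-freeness of `U` forces `z =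
  -- []`.
  prefix_free y p q hp hq hpq := by
    obtain ⟨z, rfl⟩ := hpq
    obtain ⟨u, hu⟩ := Part.dom_iff_mem.1 hp
    obtain ⟨v, hv⟩ := Part.dom_iff_mem.1 hq
    simp only [adaptationMachine, Part.mem_bind_iff] at hu hv
    obtain ⟨d, hd, t, ht, hu⟩ := hu
    obtain ⟨d', hd', t', ht', hv⟩ := hv
    obtain rfl := Part.mem_unique hd hd'
    obtain rfl := Part.mem_unique ht' (fix_simStep_append z ht)
    have := hU.prefix_free _ _ _ (Part.dom_iff_mem.2 ⟨u, hu⟩) (Part.dom_iff_mem.2 ⟨v, hv⟩)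
      (List.prefix_append _ _)
    obtain rfl : z = [] := by simpa using this
    simp

theorem AdaptationProcess.Run.exists_mem_adaptationMachine {P : AdaptationProcess}
    {U : List Bool → List Bool →. List Bool} {r S₀ D S W p σ : List Bool} {q H : ℕ}
    (h : P.Run (0, S₀, D) H (q, S, W)) (hr : P.desc ∈ U r D) (hp : σ ∈ U p S) :
    ∃ x, x.length = H + p.length ∧ σ ∈ adaptationMachine U r S₀ x D := by
  obtain ⟨w, hw, hz⟩ := h.exists_fix_simStep
  refine ⟨w ++ p, by simp [hw], ?_⟩
  simp only [adaptationMachine, Part.mem_bind_iff]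
  exact ⟨P.desc, hr, (S, p), P.codeOfBits_desc ▸ hz p, hp⟩

/-! ### Universal machines and the clock lemma -/

/-- By universality this machine shows that every string has a `U`-program on every condition, so
the infimum in `condK` is attained. -/
theorem isPrefixMachine_const (x : List Bool) :
    IsPrefixMachine fun p _ => (bif p.isEmpty then some x else none : Option (List Bool)) where
  partrec := by
    have h : Primrec fun a : List Bool × List Bool => a.1.isEmpty :=
      (Primrec.beq.comp (Primrec.list_length.comp Primrec.fst) (Primrec.const 0)).of_eq fun a => by
        cases a.1 <;> rfl
    exact Computable.ofOption
      (Computable.cond h.to_comp (Computable.const (some x)) (Computable.const none))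
  prefix_free y p q hp hq _ := by
    have key : ∀ p : List Bool,
        ((bif p.isEmpty then some x else none : Option (List Bool)) : Part (List Bool)).Dom → p = [] := by
      intro p h
      cases p with
      | nil => rfl
      | cons b p => exact absurd h (by simp)
    rw [key p hp, key q hq]

/-- Used for `K(σ | D) ≤ K(σ) + O(1)`, which settles strings `σ` of bounded complexity. -/
theorem IsPrefixMachine.ignore_condition {U : List Bool → List Bool →. List Bool}
    (hU : IsPrefixMachine U) :
    IsPrefixMachine fun p _ => U p [] where
  partrec := hU.partrec.comp Computable.fst (Computable.const [])
  prefix_free _ := hU.prefix_free []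

namespace IsUniversalPrefixMachine

variable {U : List Bool → List Bool →. List Bool}

/-- Every string has a shortest program. -/
theorem exists_program (hU : IsUniversalPrefixMachine U) (x y : List Bool) :
    ∃ p, p.length = condK U x y ∧ x ∈ U p y := by
  obtain ⟨c, hc⟩ := hU.universal _ (isPrefixMachine_const x)
  obtain ⟨q, -, hq⟩ := hc [] y x (by simp)
  exact Nat.sInf_mem (s := {n | ∃ p : List Bool, p.length = n ∧ x ∈ U p y}) ⟨_, q, rfl, hq⟩

theorem condK_le {p x y : List Bool} (h : x ∈ U p y) : condK U x y ≤ p.length :=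
  Nat.sInf_le ⟨p, rfl, h⟩

theorem exists_condK_le (hU : IsUniversalPrefixMachine U)
    {V : List Bool → List Bool →. List Bool} (hV : IsPrefixMachine V) :
    ∃ c, ∀ p x y, x ∈ V p y → condK U x y ≤ p.length + c := by
  obtain ⟨c, hc⟩ := hU.universal V hV
  refine ⟨c, fun p x y h => ?_⟩
  obtain ⟨q, hq, hx⟩ := hc p y x h
  exact (condK_le hx).trans hq

/-- Any sufficiently long condition, used as a clock, shortens the description of all sufficiently
complex strings by any given constant. -/
theorem exists_condK_add_lt_prefixK (hU : IsUniversalPrefixMachine U) (c₀ : ℕ) :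
    ∃ M : ℕ, ∀ x y : List Bool, M ≤ Encodable.encode y → M ≤ prefixK U x →
      condK U x y + c₀ < prefixK U x := by
  have hU' := hU.isPrefixMachine
  obtain ⟨f, hf, hdom, hinj⟩ := exists_computable_enumeration
    (hU'.partrec.comp Computable.id (Computable.const []))
  have hsum : Summable fun n => kraftWeight (f n) :=
    summable_kraftWeight hinj fun m n p q hp hq =>
      hU'.prefix_free [] p q ((hdom p).2 ⟨m, hp⟩) ((hdom q).2 ⟨n, hq⟩)
  have henc : Computable fun a : List Bool × ℕ => Encodable.encode a.1 :=
    Computable.encode.comp Computable.fst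
  have hlate : Computable₂ fun (y : List Bool) (i : ℕ) => f (Encodable.encode y + i) :=
    hf.comp (henc.fun_add Computable.snd)
  -- This list runs through stages `m - 1`, `m - 2`, …, `0`. Truncated subtraction then repeats
  -- stage `0`, but only positions up to `m - 1 - n` are used.
  have hearly : Computable₂ fun (y : List Bool) (i : ℕ) => f (Encodable.encode y - (i + 1)) :=
    hf.comp (henc.fun_sub (Computable.snd.fun_add (Computable.const 1)))
  obtain ⟨c₁, hc₁⟩ := hU.exists_condK_le (isPrefixMachine_compressor hU' hlate)
  obtain ⟨c₂, hc₂⟩ := hU.exists_condK_le (isPrefixMachine_compressor hU' hearly)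
  -- The net gain `L - 1` must exceed `c₀` plus the overhead of either machine.
  set L := c₀ + c₁ + c₂ + 2 with hL
  -- The extra factor `1 / 2` pays for the alignment loss of the code.
  obtain ⟨M, hM⟩ := exists_sum_kraftWeight_le hsum (ε := (1 / 2) ^ (2 * L) / 2) (by positivity)
  -- The sum bounds the length of every program enumerated before stage `M`, so a string of larger
  -- complexity has its shortest program at a stage `n ≥ M`.
  refine ⟨M + ∑ n ∈ Finset.range M, ((f n).getD []).length + 1, fun x y hy hx => ?_⟩
  obtain ⟨p, hp, hxp⟩ := hU.exists_program x []
  obtain ⟨n, hn⟩ := (hdom p).1 (Part.dom_iff_mem.2 ⟨x, hxp⟩)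
  change p.length = prefixK U x at hp
  have hMn : M ≤ n := by
    by_contra h
    have := Finset.single_le_sum (f := fun n => ((f n).getD []).length)
      (fun _ _ => Nat.zero_le _) (Finset.mem_range.2 (not_le.1 h))
    simp only [hn, Option.getD_some] at this
    omega
  set m := Encodable.encode y
  have hsmall : ∀ (s : ℕ → ℕ) (i : ℕ), (∀ j ≤ i, M ≤ s j) →
      Set.InjOn s (Finset.range (i + 1)) →
      2 * ∑ j ∈ Finset.range (i + 1), kraftWeight (f (s j)) ≤ (1 / 2) ^ (2 * L) := by
    intro s i hs hsi
    have := hM ((Finset.range (i + 1)).image s) (by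
      simp only [Finset.mem_image, Finset.mem_range]
      rintro _ ⟨j, hj, rfl⟩
      exact hs j (by omega))
    rw [Finset.sum_image hsi] at this
    linarith
  rcases le_or_gt m n with hmn | hmn
  · obtain ⟨q, hq, hxq⟩ := exists_mem_compressor
      (g := fun (y : List Bool) (i : ℕ) => f (Encodable.encode y + i)) (y := y) (i := n - m)
      (by rw [← hn]; congr 1; omega) hxp
      (hsmall (fun j => m + j) (n - m) (fun j _ => by omega) fun a _ b _ h => by simpa using h)
    have := hc₁ q x y hxq
    omega
  · obtain ⟨q, hq, hxq⟩ := exists_mem_compressor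
      (g := fun (y : List Bool) (i : ℕ) => f (Encodable.encode y - (i + 1))) (y := y)
      (i := m - 1 - n) (by rw [← hn]; congr 1; omega) hxp
      (hsmall (fun j => m - (j + 1)) (m - 1 - n) (fun j _ => by omega) fun a ha b hb h => by
        simp only [Finset.coe_range, Set.mem_Iio] at ha hb h
        omega)
    have := hc₂ q x y hxq
    omega

end IsUniversalPrefixMachine

/-! ### The erasure bound -/

theorem lemma2 (U : List Bool → List Bool →. List Bool) (hU : IsUniversalPrefixMachine U)
    (c₀ c₁ : ℕ) :
    ∃ c_U : ℕ, ∀ (P : AdaptationProcess) (σ S₀ D S W : List Bool) (q H : ℕ),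
      |(condK U σ S₀ : ℤ) - (prefixK U σ : ℤ)| ≤ (c₀ : ℤ) →
      condK U P.desc D ≤ c₁ →
      P.Run (0, S₀, D) H (q, S, W) →
      (H : ℤ) ≥ algMutualInfo U S σ - algMutualInfo U D σ - (c_U : ℤ) := by
  obtain ⟨M, hM⟩ := hU.exists_condK_add_lt_prefixK c₀
  obtain ⟨c, hc⟩ := hU.exists_condK_le
    hU.isPrefixMachine.ignore_condition
  -- The overhead depends on the built-in pair `(r, S₀)`; `B` bounds it over the finite set of
  -- relevant pairs.
  choose b hb using fun a : List Bool × List Bool =>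
    hU.exists_condK_le (isPrefixMachine_adaptationMachine hU.isPrefixMachine a.1 a.2)
  have hfin : ({r : List Bool | r.length ≤ c₁} ×ˢ
      {S₀ : List Bool | Encodable.encode S₀ < M}).Finite :=
    (List.finite_length_le Bool c₁).prod
      ((Set.finite_Iio M).preimage Encodable.encode_injective.injOn)
  obtain ⟨B, hB⟩ := (hfin.image b).bddAbove
  -- `M + c` covers `σ` of complexity below `M`, and `B` covers the simulation.
  refine ⟨M + c + B, fun P σ S₀ D S W q H hσ hP hrun => ?_⟩
  suffices h : condK U σ D ≤ H + condK U σ S + (M + c + B) by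
    simp only [algMutualInfo]
    omega
  rcases lt_or_ge (prefixK U σ) M with hlow | hhigh
  · obtain ⟨p, hp, hpσ⟩ := hU.exists_program σ []
    have := hc p σ D hpσ
    change p.length = prefixK U σ at hp
    omega
  -- Otherwise `S₀` acts as a clock and lowers the complexity of `σ` by more than `c₀`,
  -- contradicting independence.
  · have hS₀ : Encodable.encode S₀ < M := by
      by_contra h
      have := hM σ S₀ (not_lt.1 h) hhigh
      rw [abs_le] at hσ
      omega
    obtain ⟨r, hr, hrP⟩ := hU.exists_program P.desc D
    obtain ⟨p, hp, hpσ⟩ := hU.exists_program σ S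
    obtain ⟨x, hx, hxσ⟩ := hrun.exists_mem_adaptationMachine hrP hpσ
    have h1 := hb (r, S₀) x σ D hxσ
    have h2 : b (r, S₀) ≤ B := hB ⟨(r, S₀), ⟨hr.trans_le hP, hS₀⟩, rfl⟩
    omega
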